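/- Let $f\in\mathbb{Z}[x_1,\dots,x_n]$ be a polynomial of total degree $d\ge 3$, let $f_d$ be its homogeneous part of degree $d$, and let $s$ be the dimension of the critical locus $\{x\in\mathbb{C}^n : \partial f_d/\partial x_1(x)=\dots=\partial f_d/\partial x_n(x)=0\}$ of $f_d$. Write $f-f(0)=\sum_{i\in\mathbb{N}^n}\beta_i x^i$, put $\operatorname{Supp}(f)=\{i\in\mathbb{N}^n : \beta_i\ne 0\}$, and let $\Delta_0(f)\subset\mathbb{R}^n$ be the convex hull of $\operatorname{Supp}(f)+(\mathbb{R}_{\ge 0})^n$. Then there is a unique real number $\sigma_f$ such that the point $(1/\sigma_f,\dots,1/\sigma_f)$ lies in a proper face of $\Delta_0(f)$, and it satisfies $$\sigma_f\ \ge\ \frac{n-s}{d}.$$ Equality $\sigma_f=(n-s)/d$ holds if and only if there are indices $1\le i_1<\dots<i_{n-s}\le n$ and a smooth form $g$ of degree $d$ in $n-s$ variables with integer coefficients (that is, a homogeneous polynomial of degree $d$ whose partial derivatives have the origin as their only common zero in $\mathbb{C}^{n-s}$) such that $$f(x)-f(0)=g(x_{i_1},\dots,x_{i_{n-s}}).$$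 -/

import Mathlib

open scoped Pointwise

/-- The exponent vectors, in `ℝⁿ`, of the monomials that occur in `f - f(0)`. -/
def newtonSupport {n : ℕ} (f : MvPolynomial (Fin n) ℤ) : Set (Fin n → ℝ) :=
  {a | ∃ m ∈ (f - MvPolynomial.C (MvPolynomial.eval 0 f)).support, a = fun i => (m i : ℝ)}

/-- The Newton polyhedron of `f - f(0)` at zero: the convex hull of the sum set of the support
of `f - f(0)` and the nonnegative orthant. -/
def newtonPolyhedron {n : ℕ} (f : MvPolynomial (Fin n) ℤ) : Set (Fin n → ℝ) :=
  convexHull ℝ (newtonSupport f + Set.Ici (0 : Fin n → ℝ))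

/-- `(1/σ, …, 1/σ)` lies in a proper face of the Newton polyhedron of `f - f(0)` at zero.
A face is the set of maximizers on the polyhedron of a linear functional. -/
def IsNewtonSigma {n : ℕ} (f : MvPolynomial (Fin n) ℤ) (σ : ℝ) : Prop :=
  ∃ τ : Set (Fin n → ℝ), IsExposed ℝ (newtonPolyhedron f) τ ∧ τ ≠ newtonPolyhedron f ∧
    (fun _ => 1 / σ) ∈ τ

/-- The critical locus in `ℂⁿ` of an integer polynomial: the common zeros of its partial
derivatives. -/
def critLocus {n : ℕ} (g : MvPolynomial (Fin n) ℤ) : Set (Fin n → ℂ) :=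
  {x | ∀ i, MvPolynomial.aeval x (MvPolynomial.pderiv i g) = 0}

/-- The dimension of an algebraic subset `Z` of `ℂⁿ`: the Krull dimension of its coordinate
ring `ℂ[x₁, …, xₙ] / I(Z)`. -/
noncomputable def algDim {n : ℕ} (Z : Set (Fin n → ℂ)) : WithBot ℕ∞ :=
  ringKrullDim (MvPolynomial (Fin n) ℂ ⧸ MvPolynomial.vanishingIdeal ℂ Z)

/-- `g` is a smooth form of degree `d`: it is homogeneous of degree `d`, and the origin is the
only complex common zero of its partial derivatives. -/
def IsSmoothForm {m : ℕ} (g : MvPolynomial (Fin m) ℤ) (d : ℕ) : Prop :=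
  g.IsHomogeneous d ∧ critLocus g = {0}

/-! A hyperplane supporting the Newton polyhedron at `(1/σ_f, …, 1/σ_f)` shows that `σ_f` is the
least total weight `∑ i, w i` of a nonnegative weight `w` for which every monomial of
`F = f - f(0)` has weight at least one.

Fix such a `w` with `∑ i, w i = σ_f` and a threshold `c`. On the coordinate subspace
`{x | x j = 0 whenever w j > c}`, the derivative `∂ᵢF_d` vanishes as soon as
`w i + (d - 1) * c < 1`, since each of its monomials has weight larger than `(d - 1) * c` and so
involves some `x j` with `w j > c`. Counting equations,
`n - s ≤ #{i | w i > c} + #{i | w i ≥ 1 - (d - 1) * c}` for every `c`. Consequently the `n - s`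
largest weights, listed in increasing order as `u`, satisfy `u (rev a) + (d - 1) * u a ≥ 1`, and
summing over `a` gives `d * ∑ a, u a ≥ n - s`.

In the case of equality all these inequalities are equalities. Comparing the ones at `a` and
`rev a` gives `(d - 2) * (u a - u (rev a)) = 0`, so every `u a` is `1 / d` because `d > 2`, and
the remaining weights vanish. Hence `F` is a form of degree `d` in the corresponding `n - s`
variables. A singular point of this form other than the origin would span a line of critical
points, making the critical locus of `F` of dimension more than `s`. -/

open MvPolynomial
open scoped Finset

section ExposedFaces

theorem disjoint_pi_Iio_of_isLeast {ι : Type*} [Finite ι] {Δ : Set (ι → ℝ)} {t : ℝ}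
    (hΔ : IsUpperSet Δ) (ht : IsLeast {r : ℝ | (fun _ => r) ∈ Δ} t) :
    Disjoint (Set.univ.pi fun _ => Set.Iio t) Δ := by
  refine Set.disjoint_left.2 fun y hyt hyΔ => ?_
  have hev : ∀ᶠ r in nhdsWithin t (Set.Iio t), ∀ i, y i < r :=
    Filter.eventually_all.2 fun i =>
      (eventually_gt_nhds (Set.mem_Iio.1 (hyt i trivial))).filter_mono nhdsWithin_le_nhds
  obtain ⟨r, hyr, hrt⟩ := (hev.and self_mem_nhdsWithin).exists
  exact (ht.2 (hΔ (fun i => (hyr i).le) hyΔ)).not_gt hrt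

variable {ι : Type*} [Fintype ι] {Δ : Set (ι → ℝ)} {w x : ι → ℝ} {t : ℝ}

theorem exists_forall_eq_dotProduct (l : StrongDual ℝ (ι → ℝ)) :
    ∃ w : ι → ℝ, ∀ y, l y = w ⬝ᵥ y := by
  classical
  obtain ⟨w, hw⟩ := (dotProductEquiv ℝ ι).surjective l.toLinearMap
  exact ⟨w, fun y => (LinearMap.congr_fun hw y).symm⟩

theorem nonneg_of_forall_dotProduct_le (hΔ : IsUpperSet Δ) (hx : x ∈ Δ)
    (h : ∀ y ∈ Δ, w ⬝ᵥ x ≤ w ⬝ᵥ y) : 0 ≤ w := by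
  classical
  intro i
  have hmem : x + Pi.single i 1 ∈ Δ :=
    hΔ (le_add_of_nonneg_right (Pi.single_nonneg.2 zero_le_one)) hx
  simpa [dotProduct_add] using h _ hmem

theorem exists_proper_isExposed_mem_iff (hΔ : IsUpperSet Δ) (hx : x ∈ Δ) :
    (∃ τ, IsExposed ℝ Δ τ ∧ τ ≠ Δ ∧ x ∈ τ) ↔
      ∃ w : ι → ℝ, 0 < w ∧ ∀ y ∈ Δ, w ⬝ᵥ x ≤ w ⬝ᵥ y := by
  classical
  constructor
  · rintro ⟨τ, hτ, hne, hxτ⟩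
    obtain ⟨l, rfl⟩ := hτ ⟨x, hxτ⟩
    obtain ⟨w, hw⟩ := exists_forall_eq_dotProduct (-l)
    have hmin : ∀ y ∈ Δ, w ⬝ᵥ x ≤ w ⬝ᵥ y := fun y hy => by
      simpa [← hw] using hxτ.2 y hy
    refine ⟨w, (nonneg_of_forall_dotProduct_le hΔ hx hmin).lt_of_ne ?_, hmin⟩
    rintro rfl
    have hl : ∀ y, l y = 0 := fun y => by simpa using hw y
    simp [hl] at hne
  · rintro ⟨w, hw, hmin⟩
    let l : StrongDual ℝ (ι → ℝ) := (dotProductEquiv ℝ ι (-w)).toContinuousLinearMap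
    have hl : ∀ y, l y = -(w ⬝ᵥ y) := fun y => neg_dotProduct w y
    refine ⟨{y ∈ Δ | ∀ z ∈ Δ, l z ≤ l y}, fun _ => ⟨l, rfl⟩, fun heq => ?_, hx, by simpa [hl]⟩
    have hx1 : x + 1 ∈ Δ := hΔ (le_add_of_nonneg_right zero_le_one) hx
    rw [← heq] at hx1
    have hle := hx1.2 x hx
    simp only [hl, dotProduct_add, dotProduct_one] at hle
    linarith [Fintype.sum_pos hw]

theorem isLeast_diagonal_iff (hconv : Convex ℝ Δ) (hΔ : IsUpperSet Δ) :
    IsLeast {r : ℝ | (fun _ => r) ∈ Δ} t ↔ (fun _ => t) ∈ Δ ∧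
      ∃ w : ι → ℝ, 0 < w ∧ ∀ y ∈ Δ, w ⬝ᵥ (fun _ => t) ≤ w ⬝ᵥ y := by
  constructor
  · intro ht
    obtain ⟨l, u, hlt, hle⟩ := geometric_hahn_banach_open
      (convex_pi fun _ _ => convex_Iio t) (isOpen_set_pi Set.finite_univ fun _ _ => isOpen_Iio)
      hconv (disjoint_pi_Iio_of_isLeast hΔ ht)
    obtain ⟨w, hw⟩ := exists_forall_eq_dotProduct l
    have hcl : (fun _ => t) ∈ closure (Set.univ.pi fun _ : ι => Set.Iio t) := by
      simp [closure_pi_set]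
    have hlu : l (fun _ => t) ≤ u := closure_minimal (fun y hy => (hlt y hy).le)
      (isClosed_le l.continuous continuous_const) hcl
    have hmin : ∀ y ∈ Δ, w ⬝ᵥ (fun _ => t) ≤ w ⬝ᵥ y := fun y hy => by
      simpa only [← hw] using hlu.trans (hle y hy)
    refine ⟨ht.1, w, (nonneg_of_forall_dotProduct_le hΔ ht.1 hmin).lt_of_ne ?_, hmin⟩
    rintro rfl
    have h0 := hlt (fun _ => t - 1) fun i _ => by simp
    have hu := hle _ ht.1
    simp only [hw, zero_dotProduct] at h0 hu
    linarith
  · rintro ⟨ht, w, hw, hmin⟩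
    refine ⟨ht, fun r hr => le_of_mul_le_mul_left ?_ (Fintype.sum_pos hw)⟩
    simpa only [dotProduct, Finset.sum_mul] using hmin _ hr

end ExposedFaces

section Weights

variable {ι : Type*} {w : ι → ℝ} {m : ι →₀ ℕ} {c : ℝ}

theorem dotProduct_natCast_eq_weight [Fintype ι] (w : ι → ℝ) (m : ι →₀ ℕ) :
    w ⬝ᵥ (fun i => (m i : ℝ)) = Finsupp.weight w m := by
  simp [Finsupp.weight_eq_sum, dotProduct, mul_comm]

theorem degree_mul_eq_sum (m : ι →₀ ℕ) (c : ℝ) : m.degree * c = ∑ i ∈ m.support, m i • c := by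
  simp [Finsupp.degree_apply, Finset.sum_mul]

theorem weight_le_degree_mul (h : ∀ i ∈ m.support, w i ≤ c) :
    Finsupp.weight w m ≤ m.degree * c := by
  rw [degree_mul_eq_sum, Finsupp.weight_apply]
  exact Finset.sum_le_sum fun i hi => nsmul_le_nsmul_right (h i hi) _

theorem weight_eq_degree_mul_iff (h : ∀ i ∈ m.support, w i ≤ c) :
    Finsupp.weight w m = m.degree * c ↔ ∀ i ∈ m.support, w i = c := by
  rw [degree_mul_eq_sum, Finsupp.weight_apply, Finsupp.sum,
    Finset.sum_eq_sum_iff_of_le fun i hi => nsmul_le_nsmul_right (h i hi) _]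
  refine forall₂_congr fun i hi => ?_
  simp [Finsupp.mem_support_iff.1 hi]

end Weights

/-- The weight `w` gives weight at least one to every monomial of `p`. For `p = f - f(0)`, the
nonnegative weights with this property are the linear functionals that are at least one on the
Newton polyhedron of `f`. -/
def IsAdmissibleWeight {ι R : Type*} [CommSemiring R] (p : MvPolynomial ι R) (w : ι → ℝ) : Prop :=
  ∀ m ∈ p.support, 1 ≤ Finsupp.weight w m

section NewtonPolyhedron

variable {n : ℕ} {f : MvPolynomial (Fin n) ℤ} {σ : ℝ} {w : Fin n → ℝ}

theorem newtonSupport_eq_image (f : MvPolynomial (Fin n) ℤ) : newtonSupport f =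
    (fun (m : Fin n →₀ ℕ) i => (m i : ℝ)) '' (f - C (eval 0 f)).support := by
  ext a
  simp only [newtonSupport, Set.mem_ofPred_eq, Set.mem_image, Finset.mem_coe, eq_comm]

theorem newtonPolyhedron_eq_convexHull_add (f : MvPolynomial (Fin n) ℤ) :
    newtonPolyhedron f = convexHull ℝ (newtonSupport f) + Set.Ici 0 := by
  rw [newtonPolyhedron, convexHull_add, (convex_Ici (0 : Fin n → ℝ)).convexHull_eq]

theorem convex_newtonPolyhedron (f : MvPolynomial (Fin n) ℤ) : Convex ℝ (newtonPolyhedron f) :=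
  convex_convexHull _ _

theorem isUpperSet_newtonPolyhedron (f : MvPolynomial (Fin n) ℤ) :
    IsUpperSet (newtonPolyhedron f) := by
  rw [newtonPolyhedron_eq_convexHull_add]
  exact (isUpperSet_Ici 0).add_left

theorem isClosed_newtonPolyhedron (f : MvPolynomial (Fin n) ℤ) :
    IsClosed (newtonPolyhedron f) := by
  have hfin : (newtonSupport f).Finite := by
    rw [newtonSupport_eq_image]
    exact (Finset.finite_toSet _).image _
  rw [newtonPolyhedron_eq_convexHull_add]
  exact isClosed_Ici.add_left_of_isCompact (hfin.isCompact_convexHull ℝ)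

theorem natCast_mem_newtonPolyhedron {m : Fin n →₀ ℕ} (hm : m ∈ (f - C (eval 0 f)).support) :
    (fun i => (m i : ℝ)) ∈ newtonPolyhedron f :=
  subset_convexHull _ _ ⟨_, ⟨m, hm, rfl⟩, 0, Set.mem_Ici.2 le_rfl, add_zero _⟩

theorem isAdmissibleWeight_sub_C_iff (hw : 0 ≤ w) :
    IsAdmissibleWeight (f - C (eval 0 f)) w ↔ ∀ y ∈ newtonPolyhedron f, 1 ≤ w ⬝ᵥ y := by
  refine ⟨fun h => convexHull_min ?_ (convex_halfSpace_ge (dotProductBilin ℝ ℝ w).isLinear 1),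
    fun h m hm => ?_⟩
  · rintro _ ⟨_, ⟨m, hm, rfl⟩, b, hb, rfl⟩
    have hm' := (h m hm).trans_eq (dotProduct_natCast_eq_weight w m).symm
    exact hm'.trans (dotProduct_le_dotProduct_of_nonneg_left (le_add_of_nonneg_right hb) hw)
  · exact (h _ (natCast_mem_newtonPolyhedron hm)).trans_eq (dotProduct_natCast_eq_weight w m)

theorem isAdmissibleWeight_one (f : MvPolynomial (Fin n) ℤ) :
    IsAdmissibleWeight (f - C (eval 0 f)) 1 := by
  intro m hm
  have hm0 : m ≠ 0 := by
    rintro rfl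
    simp [← constantCoeff_eq, eval_zero] at hm
  have hdeg : Finsupp.weight (1 : Fin n → ℝ) m = m.degree * 1 :=
    (weight_eq_degree_mul_iff (by simp)).2 (by simp)
  rw [hdeg, mul_one, Nat.one_le_cast, Nat.one_le_iff_ne_zero, Ne, Finsupp.degree_eq_zero_iff]
  exact hm0

theorem pos_of_const_mem_newtonPolyhedron {t : ℝ} (ht : (fun _ => t) ∈ newtonPolyhedron f) :
    0 < t := by
  have hnt : 1 ≤ n * t := by
    simpa [one_dotProduct] using
      (isAdmissibleWeight_sub_C_iff zero_le_one).1 (isAdmissibleWeight_one f) _ ht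
  exact pos_of_mul_pos_right (zero_lt_one.trans_le hnt) n.cast_nonneg

theorem isNewtonSigma_iff_isLeast :
    IsNewtonSigma f σ ↔ IsLeast {t : ℝ | (fun _ => t) ∈ newtonPolyhedron f} (1 / σ) := by
  have hup := isUpperSet_newtonPolyhedron f
  rw [isLeast_diagonal_iff (convex_newtonPolyhedron f) hup]
  constructor
  · rintro ⟨τ, hτ, hne, hmem⟩
    have hΔ := hτ.subset hmem
    exact ⟨hΔ, (exists_proper_isExposed_mem_iff hup hΔ).1 ⟨τ, hτ, hne, hmem⟩⟩
  · rintro ⟨hΔ, hw⟩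
    exact (exists_proper_isExposed_mem_iff hup hΔ).2 hw

theorem IsNewtonSigma.pos (hσ : IsNewtonSigma f σ) : 0 < σ :=
  one_div_pos.1 (pos_of_const_mem_newtonPolyhedron (isNewtonSigma_iff_isLeast.1 hσ).1)

theorem existsUnique_isNewtonSigma (hf : f - C (eval 0 f) ≠ 0) : ∃! σ, IsNewtonSigma f σ := by
  let D : Set ℝ := {t | (fun _ => t) ∈ newtonPolyhedron f}
  obtain ⟨m, hm⟩ := support_nonempty.2 hf
  have hclosed : IsClosed D := (isClosed_newtonPolyhedron f).preimage (by fun_prop)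
  have hbdd : BddBelow D := ⟨0, fun t ht => (pos_of_const_mem_newtonPolyhedron ht).le⟩
  have hne : D.Nonempty := ⟨m.degree, isUpperSet_newtonPolyhedron f
    (fun i => Nat.cast_le.2 (Finsupp.le_degree i m)) (natCast_mem_newtonPolyhedron hm)⟩
  have hleast : IsLeast D (1 / (1 / sInf D)) := by
    simpa only [one_div_one_div] using hclosed.isLeast_csInf hne hbdd
  refine ⟨1 / sInf D, isNewtonSigma_iff_isLeast.2 hleast, fun σ hσ => ?_⟩
  exact inv_injective (by simpa using (isNewtonSigma_iff_isLeast.1 hσ).unique hleast)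

theorem IsNewtonSigma.le_sum_of_isAdmissibleWeight (hσ : IsNewtonSigma f σ) (hw : 0 ≤ w)
    (hadm : IsAdmissibleWeight (f - C (eval 0 f)) w) : σ ≤ ∑ i, w i := by
  have hmem := (isNewtonSigma_iff_isLeast.1 hσ).1
  have hle := (isAdmissibleWeight_sub_C_iff hw).1 hadm _ hmem
  rwa [dotProduct, ← Finset.sum_mul, mul_one_div, one_le_div hσ.pos] at hle

theorem IsNewtonSigma.exists_isAdmissibleWeight (hσ : IsNewtonSigma f σ) :
    ∃ w : Fin n → ℝ, 0 ≤ w ∧ IsAdmissibleWeight (f - C (eval 0 f)) w ∧ ∑ i, w i = σ := by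
  obtain ⟨-, w, hw, hmin⟩ := (isLeast_diagonal_iff (convex_newtonPolyhedron f)
    (isUpperSet_newtonPolyhedron f)).1 (isNewtonSigma_iff_isLeast.1 hσ)
  have hpos := hσ.pos
  have hsum := Fintype.sum_pos hw
  have hnonneg : 0 ≤ (σ / ∑ i, w i) • w := smul_nonneg (by positivity) hw.le
  refine ⟨(σ / ∑ i, w i) • w, hnonneg,
    (isAdmissibleWeight_sub_C_iff hnonneg).2 fun y hy => ?_, ?_⟩
  · have hy' := hmin y hy
    rw [dotProduct, ← Finset.sum_mul, mul_one_div] at hy'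
    rw [smul_dotProduct, smul_eq_mul, div_mul_eq_mul_div, one_le_div hsum, mul_comm]
    exact (div_le_iff₀ hpos).1 hy'
  · simp only [Pi.smul_apply, smul_eq_mul, ← Finset.mul_sum]
    exact div_mul_cancel₀ _ hsum.ne'

end NewtonPolyhedron

section Codimension

variable {ι κ K : Type*} [Field K]

/-- The translation automorphism `p(X) ↦ p(X + x)` of the polynomial ring; it moves the point `x`
to the origin. -/
noncomputable def translateEquiv (x : ι → K) : MvPolynomial ι K ≃ₐ[K] MvPolynomial ι K :=
  AlgEquiv.ofAlgHom (aeval fun i => X i + C (x i)) (aeval fun i => X i - C (x i))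
    (by ext i; simp) (by ext i; simp)

theorem aeval_translateEquiv (x y : ι → K) (p : MvPolynomial ι K) :
    aeval y (translateEquiv x p) = aeval (y + x) p := by
  have hcomp : (aeval y).comp (translateEquiv x).toAlgHom = aeval (R := K) (y + x) := by
    ext i
    simp [translateEquiv]
  exact DFunLike.congr_fun hcomp p

theorem height_vanishingIdeal_singleton_eq (x : ι → K) :
    (vanishingIdeal K {x}).height = (vanishingIdeal K {(0 : ι → K)}).height := by
  have hcomap : vanishingIdeal K {x} =
      (vanishingIdeal K {(0 : ι → K)}).comap (translateEquiv x : _ ≃+* _) := by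
    ext p
    rw [Ideal.mem_comap, mem_vanishingIdeal_singleton_iff, mem_vanishingIdeal_singleton_iff,
      AlgEquiv.coe_ringEquiv, aeval_translateEquiv, zero_add]
  rw [hcomap]
  exact RingEquiv.height_comap _ _

variable [Finite ι]

theorem ringKrullDim_mvPolynomial_field : ringKrullDim (MvPolynomial ι K) = Nat.card ι := by
  rw [MvPolynomial.ringKrullDim_of_isNoetherianRing, ringKrullDim_eq_zero_of_field, zero_add]

variable [IsAlgClosed K]

theorem card_le_height_vanishingIdeal_singleton (x : ι → K) :
    (Nat.card ι : WithBot ℕ∞) ≤ (vanishingIdeal K {x}).height := by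
  rw [← ringKrullDim_mvPolynomial_field (K := K)]
  -- By translation, all maximal ideals have the same height.
  refine (ringKrullDim_le_iff_isMaximal_height_le _).2 fun M hM => ?_
  obtain ⟨y, rfl⟩ := eq_vanishingIdeal_singleton_of_isMaximal K hM
  rw [height_vanishingIdeal_singleton_eq x, height_vanishingIdeal_singleton_eq y]

theorem ringKrullDim_quotient_span_le {Z : Set (ι → K)} {S : Set (MvPolynomial ι K)}
    (hZ : ∀ y : ι → K, (∀ p ∈ S, aeval y p = 0) → y ∈ Z) :
    ringKrullDim (MvPolynomial ι K ⧸ Ideal.span S) ≤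
      ringKrullDim (MvPolynomial ι K ⧸ vanishingIdeal K Z) := by
  have hrad : vanishingIdeal K Z ≤ (Ideal.span S).radical := by
    rw [← vanishingIdeal_zeroLocus_eq_radical (K := K), zeroLocus_span]
    exact vanishingIdeal_anti_mono hZ
  rw [ringKrullDim_quotient, ← PrimeSpectrum.zeroLocus_radical, ← ringKrullDim_quotient]
  exact ringKrullDim_le_of_surjective _ (Ideal.Quotient.factor_surjective hrad)

theorem card_le_ringKrullDim_add_card [Fintype κ] {Z : Set (ι → K)} (p : κ → MvPolynomial ι K)
    {x : ι → K} (hx : ∀ k, aeval x (p k) = 0)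
    (hZ : ∀ y : ι → K, (∀ k, aeval y (p k) = 0) → y ∈ Z) :
    (Nat.card ι : WithBot ℕ∞) ≤
      ringKrullDim (MvPolynomial ι K ⧸ vanishingIdeal K Z) + Fintype.card κ := by
  have hsub : Set.range p ⊆ (vanishingIdeal K {x} : Set (MvPolynomial ι K)) :=
    Set.range_subset_iff.2 fun k => (mem_vanishingIdeal_singleton_iff x _).2 (hx k)
  have hcard : (Set.range p).encard ≤ Fintype.card κ := by
    rw [← Set.image_univ]
    exact (Set.encard_image_le _ _).trans_eq (by simp)
  calc (Nat.card ι : WithBot ℕ∞)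
      ≤ (vanishingIdeal K {x}).height := card_le_height_vanishingIdeal_singleton x
    _ ≤ ringKrullDim (MvPolynomial ι K ⧸ Ideal.span (Set.range p)) + (Set.range p).encard :=
        Ideal.height_le_ringKrullDim_quotient_add_encard _ hsub
    _ ≤ _ := add_le_add (ringKrullDim_quotient_span_le (by simpa using hZ))
        (WithBot.coe_le_coe.2 hcard)

end Codimension

section AlgebraicDimension

variable {n k : ℕ} {Z : Set (Fin n → ℂ)}

theorem algDim_le (Z : Set (Fin n → ℂ)) : algDim Z ≤ n := by
  simpa [algDim, ringKrullDim_mvPolynomial_field] using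
    ringKrullDim_quotient_le (vanishingIdeal ℂ Z)

theorem le_algDim_add_card {κ : Type*} [Fintype κ] (p : κ → MvPolynomial (Fin n) ℂ)
    {x : Fin n → ℂ} (hx : ∀ k, aeval x (p k) = 0)
    (hZ : ∀ y : Fin n → ℂ, (∀ k, aeval y (p k) = 0) → y ∈ Z) :
    (n : WithBot ℕ∞) ≤ algDim Z + Fintype.card κ := by
  simpa [algDim] using card_le_ringKrullDim_add_card p hx hZ

theorem le_algDim_add_of_line_subset (ι : Fin k → Fin n) {x : Fin k → ℂ} (hx : x ≠ 0)
    (hZ : ∀ y : Fin n → ℂ, (∃ c : ℂ, y ∘ ι = c • x) → y ∈ Z) :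
    (n : WithBot ℕ∞) ≤ algDim Z + (k - 1 : ℕ) := by
  obtain ⟨a, ha⟩ := Function.ne_iff.1 hx
  -- The line through `x` is cut out by the `k - 1` minors that involve the coordinate `a`.
  let p : {b // b ≠ a} → MvPolynomial (Fin n) ℂ :=
    fun b => C (x a) * X (ι b) - C (x b) * X (ι a)
  have hcodim := le_algDim_add_card (Z := Z) p (x := 0) (by simp [p]) fun y hy => by
    refine hZ y ⟨y (ι a) / x a, funext fun b => ?_⟩
    have ha' : x a ≠ 0 := ha
    suffices hb : x a * y (ι b) = x b * y (ι a) by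
      rw [Function.comp_apply, Pi.smul_apply, smul_eq_mul]
      field_simp
      linear_combination hb
    by_cases hba : b = a
    · rw [hba]
    · simpa [p, sub_eq_zero] using hy ⟨b, hba⟩
  simpa using hcodim

end AlgebraicDimension

section CriticalLocus

variable {n k d : ℕ}

theorem aeval_smul_of_isHomogeneous {ι R A : Type*} [CommSemiring R] [CommSemiring A] [Algebra R A]
    {p : MvPolynomial ι R} (hp : p.IsHomogeneous d) (c : A) (x : ι → A) :
    aeval (c • x) p = c ^ d * aeval x p := by
  rw [aeval_def, aeval_def, eval₂_eq, eval₂_eq, Finset.mul_sum]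
  refine Finset.sum_congr rfl fun m hm => ?_
  simp only [Pi.smul_apply, smul_eq_mul, mul_pow, Finset.prod_mul_distrib,
    Finset.prod_pow_eq_pow_sum, ← hp.degree_eq_sum_deg_support hm]
  ring

theorem aeval_pderiv_eq_zero {ι R A : Type*} [CommSemiring R] [CommSemiring A] [Algebra R A]
    {p : MvPolynomial ι R} {i : ι} {x : ι → A}
    (h : ∀ m ∈ p.support, m i ≠ 0 → ∃ j ∈ (m - Finsupp.single i 1).support, x j = 0) :
    aeval x (pderiv i p) = 0 := by
  rw [p.as_sum, map_sum, map_sum]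
  refine Finset.sum_eq_zero fun m hm => ?_
  rw [pderiv_monomial, aeval_monomial]
  by_cases hmi : m i = 0
  · simp [hmi]
  · obtain ⟨j, hj, hxj⟩ := h m hm hmi
    rw [Finsupp.prod, Finset.prod_eq_zero hj, mul_zero]
    rw [hxj, zero_pow (Finsupp.mem_support_iff.1 hj)]

theorem zero_mem_critLocus {p : MvPolynomial (Fin n) ℤ} (hp : p.IsHomogeneous d) (hd : 2 ≤ d) :
    0 ∈ critLocus p := by
  intro i
  rw [aeval_zero, constantCoeff_eq, hp.pderiv.coeff_eq_zero (by simp; omega), map_zero]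

theorem smul_mem_critLocus {p : MvPolynomial (Fin n) ℤ} (hp : p.IsHomogeneous d) (c : ℂ)
    {x : Fin n → ℂ} (hx : x ∈ critLocus p) : c • x ∈ critLocus p := by
  intro i
  rw [aeval_smul_of_isHomogeneous hp.pderiv, hx i, mul_zero]

theorem mem_critLocus_rename_iff {g : MvPolynomial (Fin k) ℤ} {ι : Fin k → Fin n}
    (hι : Function.Injective ι) {y : Fin n → ℂ} :
    y ∈ critLocus (rename ι g) ↔ y ∘ ι ∈ critLocus g := by
  have hderiv (a : Fin k) :
      aeval y (pderiv (ι a) (rename ι g)) = aeval (y ∘ ι) (pderiv a g) := by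
    rw [pderiv_rename hι, aeval_rename]
  refine ⟨fun hy a => hderiv a ▸ hy (ι a), fun hy i => ?_⟩
  by_cases hi : i ∈ Set.range ι
  · obtain ⟨a, rfl⟩ := hi
    rw [hderiv, hy a]
  · have hvars : i ∉ (rename ι g).vars := fun hmem =>
      hi (Set.mem_range.2 ((Finset.mem_image.1 (vars_rename ι g hmem)).imp fun _ h => h.2))
    rw [pderiv_eq_zero_of_notMem_vars hvars, map_zero]

theorem critLocus_eq_singleton_zero_of_algDim_rename {s : ℕ} {g : MvPolynomial (Fin k) ℤ}
    {ι : Fin k → Fin n} (hι : Function.Injective ι) (hg : g.IsHomogeneous d) (hd : 2 ≤ d)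
    (hs : algDim (critLocus (rename ι g)) = s) (hks : s + k ≤ n) : critLocus g = {0} := by
  refine Set.eq_singleton_iff_unique_mem.2 ⟨zero_mem_critLocus hg hd, fun x hx => ?_⟩
  by_contra hx0
  obtain ⟨a, -⟩ := Function.ne_iff.1 hx0
  have hcodim := le_algDim_add_of_line_subset (Z := critLocus (rename ι g)) ι hx0
    fun y ⟨c, hy⟩ => (mem_critLocus_rename_iff hι).2 (hy ▸ smul_mem_critLocus hg c hx)
  rw [hs] at hcodim
  have hn : n ≤ s + (k - 1) := by exact_mod_cast hcodim
  have := a.isLt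
  omega

theorem exists_lt_of_mul_degree_lt_weight {ι : Type*} {w : ι → ℝ} {m : ι →₀ ℕ} {c : ℝ}
    (h : m.degree * c < Finsupp.weight w m) : ∃ j ∈ m.support, c < w j := by
  by_contra! hle
  exact h.not_ge (weight_le_degree_mul hle)

theorem aeval_pderiv_eq_zero_of_weight_lt {ι R A : Type*} [CommSemiring R] [CommSemiring A]
    [Algebra R A] {p : MvPolynomial ι R} (hp : p.IsHomogeneous d) {w : ι → ℝ}
    (hw : IsAdmissibleWeight p w) {c : ℝ} {i : ι} (hi : w i + (d - 1) * c < 1) {x : ι → A}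
    (hx : ∀ j, c < w j → x j = 0) : aeval x (pderiv i p) = 0 := by
  refine aeval_pderiv_eq_zero fun m hm hmi => ?_
  have hdeg : (m - Finsupp.single i 1).degree + 1 = d := by
    rw [hp.degree_eq_sum_deg_support hm, ← Finsupp.degree_apply, Finsupp.degree_eq_weight_one]
    exact Finsupp.weight_sub_single_add (w := 1) hmi
  have hweight := Finsupp.weight_sub_single_add (w := w) hmi
  have hm1 := hw m hm
  obtain ⟨j, hj, hcj⟩ : ∃ j ∈ (m - Finsupp.single i 1).support, c < w j := by
    refine exists_lt_of_mul_degree_lt_weight ?_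
    rw [← hdeg] at hi
    push_cast at hi
    linarith
  exact ⟨j, hj, hx j hcj⟩

theorem IsAdmissibleWeight.le_algDim_critLocus_add_card {p : MvPolynomial (Fin n) ℤ}
    (hp : p.IsHomogeneous d) (hd : 2 ≤ d) {w : Fin n → ℝ} (hw : IsAdmissibleWeight p w) (c : ℝ) :
    (n : WithBot ℕ∞) ≤
      algDim (critLocus p) + (#{i | c < w i} + #{i | 1 - (d - 1) * c ≤ w i} : ℕ) := by
  classical
  let q : {i // c < w i} ⊕ {i // 1 - (d - 1) * c ≤ w i} → MvPolynomial (Fin n) ℂ :=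
    Sum.elim (fun i => X i.1) fun i => map (algebraMap ℤ ℂ) (pderiv i.1 p)
  have hcodim := le_algDim_add_card (Z := critLocus p) q (x := 0) ?_ fun y hy i => ?_
  · simpa [Fintype.card_subtype] using hcodim
  · rintro (i | i)
    · simp [q]
    · simpa [q, aeval_map_algebraMap] using zero_mem_critLocus hp hd i
  · by_cases hi : 1 - (d - 1) * c ≤ w i
    · exact (aeval_map_algebraMap ℂ y _).symm.trans (hy (Sum.inr ⟨i, hi⟩))
    · exact aeval_pderiv_eq_zero_of_weight_lt hp hw (by linarith) fun j hj => by
        simpa [q] using hy (Sum.inl ⟨j, hj⟩)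

end CriticalLocus

section Pairing

variable {n : ℕ}

theorem card_filter_le_of_perm {P : Fin n → Prop} [DecidablePred P] (e : Equiv.Perm (Fin n))
    {k : Fin n} (h : ∀ i, P (e i) → k < i) : #{i | P i} ≤ n - 1 - k := by
  have hsub : ({i | P i} : Finset (Fin n)) ⊆ (Finset.Ioi k).map e.toEmbedding := fun i hi => by
    refine Finset.mem_map.2 ⟨e.symm i, Finset.mem_Ioi.2 (h _ ?_), e.apply_symm_apply i⟩
    simpa using hi
  simpa using Finset.card_le_card hsub

theorem exists_embedding_rev_of_card {α : Type*} [LinearOrder α] (w : Fin n → α) (φ : α → α)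
    {s : ℕ} (h : ∀ c, n ≤ s + (#{i | c < w i} + #{i | φ c ≤ w i})) :
    ∃ κ : Fin (n - s) ↪ Fin n, ∀ a, φ (w (κ a)) ≤ w (κ a.rev) := by
  let e := Tuple.sort w
  have hmono : Monotone (w ∘ e) := Tuple.monotone_sort w
  -- The positions of the `n - s` largest values in the sorted list.
  let top (a : Fin (n - s)) : Fin n := ⟨s + a, by omega⟩
  have htop : Function.Injective top := fun a b hab => by simpa [top, Fin.ext_iff] using hab
  refine ⟨⟨e ∘ top, e.injective.comp htop⟩, fun a => ?_⟩
  by_contra! hlt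
  have hfst := card_filter_le_of_perm (P := fun i => w (e (top a)) < w i) e
    fun i hi => hmono.reflect_lt hi
  have hsnd := card_filter_le_of_perm (P := fun i => φ (w (e (top a))) ≤ w i) e
    (k := top a.rev) fun i hi => hmono.reflect_lt (hlt.trans_le hi)
  have hcard := h (w (e (top a)))
  simp only [top, Fin.val_rev] at hfst hsnd hcard
  omega

variable {k : ℕ} {u : Fin k → ℝ} {d : ℝ}

theorem le_mul_sum_of_rev (h : ∀ a, 1 - (d - 1) * u a ≤ u a.rev) : k ≤ d * ∑ a, u a := by
  have hsum := Finset.sum_le_sum fun a (_ : a ∈ Finset.univ) => h a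
  have hrev : ∑ a : Fin k, u a.rev = ∑ a, u a := Equiv.sum_comp Fin.revPerm u
  rw [hrev, Finset.sum_sub_distrib, ← Finset.mul_sum] at hsum
  simp only [Finset.sum_const, Finset.card_univ, Fintype.card_fin, nsmul_eq_mul, mul_one] at hsum
  linarith

theorem mul_eq_one_of_rev (hd : 2 < d) (h : ∀ a, 1 - (d - 1) * u a ≤ u a.rev)
    (heq : d * ∑ a, u a = k) (a : Fin k) : d * u a = 1 := by
  have hrev : ∑ a : Fin k, u a.rev = ∑ a, u a := Equiv.sum_comp Fin.revPerm u
  have hterm : ∀ a, 1 - (d - 1) * u a = u a.rev := by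
    refine fun a => (Finset.sum_eq_sum_iff_of_le fun a _ => h a).1 ?_ a (Finset.mem_univ a)
    rw [hrev, Finset.sum_sub_distrib, ← Finset.mul_sum]
    simp only [Finset.sum_const, Finset.card_univ, Fintype.card_fin, nsmul_eq_mul, mul_one]
    linarith
  have ha := hterm a
  have har := hterm a.rev
  rw [Fin.rev_rev] at har
  have hsymm : (d - 2) * (u a - u a.rev) = 0 := by linear_combination har - ha
  have huu : u a = u a.rev := by
    rcases mul_eq_zero.1 hsymm with h0 | h0 <;> linarith
  linear_combination huu - ha

theorem sum_embedding_le {ι κ : Type*} [Fintype ι] [Fintype κ] {w : ι → ℝ} (hw : 0 ≤ w)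
    (e : κ ↪ ι) : ∑ a, w (e a) ≤ ∑ i, w i := by
  rw [← Finset.sum_map Finset.univ e w]
  exact Finset.sum_le_univ_sum_of_nonneg hw

theorem eq_zero_of_sum_le_sum_embedding {ι κ : Type*} [Fintype ι] [Fintype κ] {w : ι → ℝ}
    (hw : 0 ≤ w) (e : κ ↪ ι) (h : ∑ i, w i ≤ ∑ a, w (e a)) {i : ι} (hi : i ∉ Set.range e) :
    w i = 0 := by
  classical
  by_contra hne
  have hpos : 0 < w i := (hw i).lt_of_ne' hne
  refine h.not_gt ?_
  rw [← Finset.sum_map Finset.univ e w]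
  exact Finset.sum_lt_sum_of_subset (Finset.subset_univ _) (Finset.mem_univ i)
    (by simpa using hi) hpos fun j _ _ => hw j

end Pairing

section AdmissibleWeights

variable {ι R : Type*} [CommSemiring R] {p : MvPolynomial ι R} {d : ℕ} {w : ι → ℝ}

theorem IsAdmissibleWeight.isHomogeneous_and_eq (hw : IsAdmissibleWeight p w) (hd : 0 < d)
    (hp : p.totalDegree ≤ d) (hle : ∀ i, d * w i ≤ 1) :
    p.IsHomogeneous d ∧ ∀ i ∈ p.vars, d * w i = 1 := by
  have hd' : (0 : ℝ) < d := Nat.cast_pos.2 hd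
  have hle' : ∀ i, w i ≤ 1 / d := fun i => (le_div_iff₀' hd').2 (hle i)
  have hdeg : ∀ m ∈ p.support, m.degree = d := fun m hm => by
    refine le_antisymm ((le_totalDegree hm).trans hp) ?_
    have h1 := (hw m hm).trans (weight_le_degree_mul fun i _ => hle' i)
    rw [mul_one_div, one_le_div hd'] at h1
    exact_mod_cast h1
  refine ⟨fun m hm => ?_, fun i hi => ?_⟩
  · have hdm := hdeg m (mem_support_iff.2 hm)
    rwa [Finsupp.degree_eq_weight_one] at hdm
  · obtain ⟨m, hm, him⟩ := (mem_vars_iff_mem_support i).1 hi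
    have hdm : m.degree * (1 / d : ℝ) = 1 := by rw [hdeg m hm, mul_one_div_cancel hd'.ne']
    have heq : Finsupp.weight w m = m.degree * (1 / d : ℝ) :=
      (weight_le_degree_mul fun i _ => hle' i).antisymm (hdm.trans_le (hw m hm))
    rw [(weight_eq_degree_mul_iff fun i _ => hle' i).1 heq i him, mul_one_div_cancel hd'.ne']

theorem isAdmissibleWeight_of_isHomogeneous (hp : p.IsHomogeneous d) (hd : d ≠ 0)
    (hw : ∀ i ∈ p.vars, d * w i = 1) : IsAdmissibleWeight p w := by
  intro m hm
  have hweight : Finsupp.weight w m = m.degree * (1 / d : ℝ) := by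
    have hw' : ∀ i ∈ m.support, w i = 1 / d := fun i hi =>
      eq_one_div_of_mul_eq_one_right (hw i ((mem_vars_iff_mem_support i).2 ⟨m, hm, hi⟩))
    exact (weight_eq_degree_mul_iff fun i hi => (hw' i hi).le).2 hw'
  rw [hweight, Finsupp.degree_apply, ← hp.degree_eq_sum_deg_support hm,
    mul_one_div_cancel (Nat.cast_ne_zero.2 hd)]

theorem IsAdmissibleWeight.homogeneousComponent (hw : IsAdmissibleWeight p w) (d : ℕ) :
    IsAdmissibleWeight (homogeneousComponent d p) w := fun m hm =>
  hw m (by rw [support_homogeneousComponent] at hm; exact Finset.mem_of_mem_filter m hm)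

theorem IsAdmissibleWeight.isHomogeneous_and_vars_subset [Fintype ι] {k : ℕ}
    (hw : IsAdmissibleWeight p w) (hw0 : 0 ≤ w) (hd : 2 < d) (hp : p.totalDegree ≤ d)
    (κ : Fin k ↪ ι) (hκ : ∀ a, 1 - (d - 1) * w (κ a) ≤ w (κ a.rev)) (hsum : d * ∑ i, w i ≤ k) :
    p.IsHomogeneous d ∧ p.vars ⊆ Finset.univ.map κ := by
  have hd2 : (2 : ℝ) < d := by exact_mod_cast hd
  have hlek : d * ∑ a, w (κ a) ≤ d * ∑ i, w i :=
    mul_le_mul_of_nonneg_left (sum_embedding_le hw0 κ) d.cast_nonneg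
  have hkle := le_mul_sum_of_rev (u := w ∘ κ) hκ
  have hon : ∀ a, d * w (κ a) = 1 :=
    mul_eq_one_of_rev hd2 hκ ((hlek.trans hsum).antisymm hkle)
  have hoff : ∀ i ∉ Set.range κ, w i = 0 := fun i hi =>
    eq_zero_of_sum_le_sum_embedding hw0 κ
      (le_of_mul_le_mul_left (hsum.trans hkle) (by linarith)) hi
  have hle : ∀ i, d * w i ≤ 1 := fun i => by
    by_cases hi : i ∈ Set.range κ
    · obtain ⟨a, rfl⟩ := hi
      exact (hon a).le
    · rw [hoff i hi, mul_zero]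
      exact zero_le_one
  obtain ⟨hhom, hvars⟩ := hw.isHomogeneous_and_eq (by omega) hp hle
  refine ⟨hhom, fun i hi => ?_⟩
  by_contra hmem
  have hwi := hvars i hi
  rw [hoff i (by simpa using hmem), mul_zero] at hwi
  exact zero_ne_one hwi

end AdmissibleWeights

section NewtonSigma

variable {n d : ℕ}

theorem homogeneousComponent_sub_C {ι R : Type*} [CommRing R] (p : MvPolynomial ι R) (r : R)
    (hd : d ≠ 0) : homogeneousComponent d (p - C r) = homogeneousComponent d p := by
  rw [map_sub, homogeneousComponent_of_mem (isHomogeneous_C ι r), if_neg hd, sub_zero]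

theorem exists_strictMono_eq_rename {ι R : Type*} [LinearOrder ι] [CommSemiring R]
    {p : MvPolynomial ι R} {S : Finset ι} (hp : p.vars ⊆ S) {k : ℕ} (hS : #S = k) :
    ∃ (g : MvPolynomial (Fin k) R) (φ : Fin k → ι), StrictMono φ ∧ p = rename φ g := by
  obtain ⟨g, hg⟩ := exists_rename_eq_of_vars_subset_range p (S.orderEmbOfFin hS)
    (S.orderEmbOfFin hS).injective (by simpa using hp)
  exact ⟨g, _, (S.orderEmbOfFin hS).strictMono, hg.symm⟩

theorem IsAdmissibleWeight.exists_embedding_rev {p : MvPolynomial (Fin n) ℤ} {w : Fin n → ℝ}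
    (hw : IsAdmissibleWeight p w) (hp : p.IsHomogeneous d) (hd : 2 ≤ d) {s : ℕ}
    (hs : algDim (critLocus p) = s) :
    ∃ κ : Fin (n - s) ↪ Fin n, ∀ a, 1 - (d - 1) * w (κ a) ≤ w (κ a.rev) := by
  refine exists_embedding_rev_of_card w (fun c => 1 - (d - 1) * c) fun c => ?_
  have hcodim := hw.le_algDim_critLocus_add_card hp hd c
  rw [hs] at hcodim
  exact_mod_cast hcodim

theorem IsNewtonSigma.le_div_of_eq_rename {f : MvPolynomial (Fin n) ℤ} {σ : ℝ}
    (hσ : IsNewtonSigma f σ) {k : ℕ} {g : MvPolynomial (Fin k) ℤ} {φ : Fin k → Fin n}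
    (hf : f - C (eval 0 f) = rename φ g) (hg : g.IsHomogeneous d) (hd : d ≠ 0) : σ ≤ k / d := by
  let w : Fin n → ℝ := fun i => if i ∈ Finset.univ.image φ then 1 / d else 0
  have hvars : ∀ i ∈ (rename φ g).vars, i ∈ Finset.univ.image φ := fun i hi =>
    Finset.image_subset_image (Finset.subset_univ _) (vars_rename φ g hi)
  have hadm : IsAdmissibleWeight (rename φ g) w :=
    isAdmissibleWeight_of_isHomogeneous hg.rename_isHomogeneous hd fun i hi => by
      rw [show w i = 1 / d from if_pos (hvars i hi), mul_one_div_cancel (Nat.cast_ne_zero.2 hd)]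
  have hw0 : 0 ≤ w := fun i => by
    dsimp only [w]
    split_ifs <;> positivity
  calc σ ≤ ∑ i, w i := hσ.le_sum_of_isAdmissibleWeight hw0 (hf ▸ hadm)
    _ = #(Finset.univ.image φ) / d := by
      rw [Finset.sum_ite_mem, Finset.univ_inter, Finset.sum_const, nsmul_eq_mul, mul_one_div]
    _ ≤ k / d := by
      gcongr
      simpa using Finset.card_image_le (s := Finset.univ) (f := φ)

end NewtonSigma

theorem mainTheorem9 (n d s : ℕ) (f : MvPolynomial (Fin n) ℤ)
    (hd : 3 ≤ d) (hf : f.totalDegree = d)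
    (hs : algDim (critLocus (MvPolynomial.homogeneousComponent d f)) = (s : WithBot ℕ∞)) :
    (∃! σ : ℝ, IsNewtonSigma f σ) ∧
    ∀ σ : ℝ, IsNewtonSigma f σ →
      ((n : ℝ) - (s : ℝ)) / (d : ℝ) ≤ σ ∧
      (σ = ((n : ℝ) - (s : ℝ)) / (d : ℝ) ↔
        ∃ (g : MvPolynomial (Fin (n - s)) ℤ) (ι : Fin (n - s) → Fin n),
          IsSmoothForm g d ∧ StrictMono ι ∧
          f - MvPolynomial.C (MvPolynomial.eval 0 f) = MvPolynomial.rename ι g) := by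
  have hd0 : d ≠ 0 := by omega
  have hsn : s ≤ n := by exact_mod_cast hs ▸ algDim_le _
  rw [← homogeneousComponent_sub_C f (eval 0 f) hd0] at hs
  have hne : f - C (eval 0 f) ≠ 0 := fun h => hd0 (by rw [← hf, sub_eq_zero.1 h, totalDegree_C])
  refine ⟨existsUnique_isNewtonSigma hne, fun σ hσ => ?_⟩
  obtain ⟨w, hw0, hadm, rfl⟩ := hσ.exists_isAdmissibleWeight
  obtain ⟨κ, hκ⟩ := (hadm.homogeneousComponent d).exists_embedding_rev
    (homogeneousComponent_isHomogeneous d _) (by omega) hs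
  rw [← Nat.cast_sub hsn]
  have hd_pos : (0 : ℝ) < d := by positivity
  have hle : ((n - s : ℕ) : ℝ) / d ≤ ∑ i, w i := (div_le_iff₀' hd_pos).2 <|
    (le_mul_sum_of_rev (u := w ∘ κ) hκ).trans
      (mul_le_mul_of_nonneg_left (sum_embedding_le hw0 κ) hd_pos.le)
  refine ⟨hle, fun heq => ?_, ?_⟩
  · obtain ⟨hhom, hvars⟩ := hadm.isHomogeneous_and_vars_subset hw0 hd
      ((totalDegree_sub_C_le f _).trans hf.le) κ hκ ((le_div_iff₀' hd_pos).1 heq.le)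
    obtain ⟨g, ι, hι, hg⟩ := exists_strictMono_eq_rename (k := n - s) hvars (by simp)
    rw [homogeneousComponent_of_mem hhom, if_pos rfl, hg] at hs
    have hg_hom := (IsHomogeneous.rename_isHomogeneous_iff hι.injective).1 (hg ▸ hhom)
    exact ⟨g, ι, ⟨hg_hom,
      critLocus_eq_singleton_zero_of_algDim_rename hι.injective hg_hom (by omega) hs (by omega)⟩,
      hι, hg⟩
  · rintro ⟨g, ι, ⟨hg_hom, -⟩, -, hg⟩
    exact (hσ.le_div_of_eq_rename hg hg_hom hd0).antisymm hle
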